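/- Let $0\le p'<p$ be integers, let $A\subset\mathbb R^{p'}$ be a bounded Borel set with Lebesgue measure $|A|$, and let $U$ be an open set containing the closure of $A$. For $1\le i\le p$ let $g_i:U\to\mathbb R^{d_i}$ be random fields on a common probability space, almost surely of class $\mathcal C^1$, such that $G=(g_1,\dots,g_p)$ is a centred Gaussian field on $U$ with values in $\mathbb R^{d_1+\dots+d_p}$. Assume that the vectors $G(x)$, $x\in A$, have densities with a common upper bound. Let $s>0$ be such that all eigenvalues of the covariance matrix of $G(x)$ are at most $s^2$, for all $x\in A$. Let $h_i:\mathbb R^{d_i}\to\mathbb R$ be subpolynomial, that is, of class $\mathcal C^1$ with $h_i$ and its differential growing at most polynomially, and assume that for $X_i\sim\mathcal N(0,s^2I_{d_i})$ the variable $h_i(X_i)$ has, for some $\varepsilon>0$, a bounded density on $[-\varepsilon,\varepsilon]$. Put $$\psi(x)=\big(h_1(g_1(x)),\dots,h_p(g_p(x))\big)\in\mathbb R^p ,$$ write $\|\cdot\|$ for the Euclidean norm, and let $0\le\alpha<1$. (1) There is a constant $c_\alpha<\infty$ such that for every $\tau>0$ $$\mathbf P\Big(\inf_{x\in A}\|\psi(x)\|\le\tau\Big)\le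 c_\alpha\,(|A|\vee 1)\,\tau^\alpha .$$ (2) For every $K<\infty$ there is a constant $c'_\alpha<\infty$ such that for every centred Gaussian field $\varphi=(\varphi_1,\dots,\varphi_p):A\to\mathbb R^p$ on the same probability space, with almost surely continuous sample paths (no independence of $\psi$ and no joint Gaussianity with $G$ is required), with maximal standard deviation $\sigma_A=\sup_{x\in A,\,k\le p}\sqrt{\mathsf{Var}(\varphi_k(x))}$ and with $\mathbf E\sup_{x\in A}\|\varphi(x)\|\le K\sigma_A$, $$\mathbf P\big(\exists x\in A:\ \|\psi(x)\|<\|\varphi(x)\|\big)\le c'_\alpha\,(|A|\vee 1)\,\sigma_A^\alpha .$$ The constants may depend on $A$, on $g_i$, $h_i$ and on $\alpha$; the constant $c'_\alpha$ depends on $\varphi$ only through $K$ (some finite $K$ exists for each $\varphi$ with almost surely bounded sample paths). -/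

import Mathlib

open MeasureTheory ProbabilityTheory
open scoped ENNReal NNReal

/-- The measure `μ` has, on the set `s`, a density with respect to Lebesgue measure that is bounded
by `C` on `s`. For `s = Set.univ` this says that `μ` has a density bounded by `C`. -/
def HasDensityBoundedOn {E : Type*} [MeasureSpace E] (μ : Measure E) (s : Set E) (C : ℝ≥0) :
    Prop :=
  ∃ f : E → ℝ≥0∞, Measurable f ∧ (∀ y ∈ s, f y ≤ C) ∧
    μ.restrict s = (volume.restrict s).withDensity f

/-- A function of class `C¹` which, together with its differential, grows at most polynomially. -/
def IsSubpolynomial {k : ℕ} (h : EuclideanSpace ℝ (Fin k) → ℝ) : Prop :=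
  ContDiff ℝ 1 h ∧
    ∃ (C : ℝ) (N : ℕ), ∀ y, |h y| ≤ C * (1 + ‖y‖) ^ N ∧ ‖fderiv ℝ h y‖ ≤ C * (1 + ‖y‖) ^ N

/-- The fields `g 1, …, g p`, with values in `ℝ^{d 1}, …, ℝ^{d p}`, are centred and jointly
Gaussian on the set `U`, and almost surely of class `C¹` there. -/
structure IsSmoothCentredGaussianOn {Ω : Type*} [MeasurableSpace Ω] (P : Measure Ω) {m p : ℕ}
    {d : Fin p → ℕ} (g : (i : Fin p) → EuclideanSpace ℝ (Fin m) → Ω → EuclideanSpace ℝ (Fin (d i)))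
    (U : Set (EuclideanSpace ℝ (Fin m))) : Prop where
  gaussian : IsGaussianProcess
    (fun (x : U) (ω : Ω) (i : Fin p) => g i (x : EuclideanSpace ℝ (Fin m)) ω) P
  centred : ∀ i, ∀ x ∈ U, ∫ ω, g i x ω ∂P = 0
  smooth : ∀ᵐ ω ∂P, ∀ i, ContDiffOn ℝ 1 (fun x => g i x ω) U

/-- The field `ψ(x) = (h 1 (g 1 x), …, h p (g p x))`, with values in Euclidean `ℝ^p`. -/
noncomputable def compField {Ω : Type*} {m p : ℕ} {d : Fin p → ℕ}
    (h : (i : Fin p) → EuclideanSpace ℝ (Fin (d i)) → ℝ)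
    (g : (i : Fin p) → EuclideanSpace ℝ (Fin m) → Ω → EuclideanSpace ℝ (Fin (d i)))
    (x : EuclideanSpace ℝ (Fin m)) (ω : Ω) : EuclideanSpace ℝ (Fin p) :=
  WithLp.toLp 2 (fun i => h i (g i x ω))

/-- `φ` is a centred Gaussian field on `A` with almost surely continuous sample paths. -/
structure IsContinuousCentredGaussianOn {Ω : Type*} [MeasurableSpace Ω] (P : Measure Ω) {m p : ℕ}
    (φ : EuclideanSpace ℝ (Fin m) → Ω → EuclideanSpace ℝ (Fin p))
    (A : Set (EuclideanSpace ℝ (Fin m))) : Prop where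
  gaussian : IsGaussianProcess
    (fun (x : A) (ω : Ω) => φ (x : EuclideanSpace ℝ (Fin m)) ω) P
  centred : ∀ x ∈ A, ∫ ω, φ x ω ∂P = 0
  continuous : ∀ᵐ ω ∂P, ContinuousOn (fun x => φ x ω) A

/-- The maximal standard deviation over `A` of the coordinates of the field `φ`. -/
noncomputable def maxStdDev {Ω : Type*} [MeasurableSpace Ω] (P : Measure Ω) {m p : ℕ}
    (φ : EuclideanSpace ℝ (Fin m) → Ω → EuclideanSpace ℝ (Fin p))
    (A : Set (EuclideanSpace ℝ (Fin m))) : ℝ≥0∞ :=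
  ⨆ x ∈ A, ⨆ k : Fin p, evariance (fun ω => φ x ω k) P ^ (1 / 2 : ℝ)

/-- The mean `E[sup_A ‖φ‖]` of the largest norm of the field `φ` on `A`. -/
noncomputable def meanSupNorm {Ω : Type*} [MeasurableSpace Ω] (P : Measure Ω) {m p : ℕ}
    (φ : EuclideanSpace ℝ (Fin m) → Ω → EuclideanSpace ℝ (Fin p))
    (A : Set (EuclideanSpace ℝ (Fin m))) : ℝ≥0∞ :=
  ∫⁻ ω, ⨆ x ∈ A, ‖φ x ω‖ₑ ∂P

/-! Write `m` for the dimension `p'`. The heart is a net argument. If `‖ψ(x)‖ < τ` somewhere on `A`,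
and the paths of `G` are bounded and Lipschitz with constant `R`, then the polynomial control of the
`h i` gives a nearby net point `y` with every `|h i (g i y)|` at most `θ`, of order `R ^ (N + 1) *
τ`. At a fixed point this has probability `O(θ ^ p)`, while a `τ`-net has `O(τ ^ (-m))` points.
Since `p ≥ m + 1`, the union bound is `O(R ^ M * τ)`. The exceptional events decay faster than any
power of `R`, so taking `R` a small negative power of `τ` costs only an arbitrarily small part of
the exponent (`exists_le_mul_rpow`).

The pointwise bound does not need independent `g i`. A bounded density bounds the determinant of the
covariance from below, so the law of `G(x)` is at most a constant times `N(0, s² I)`, uniformly in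
`x` (`exists_gaussian_pi_domination`); there the blocks are independent and the small ball
probabilities multiply.

The tails come from Fernique's theorem with universal constants, the only parameter being a scale
not exceeded with probability `3 / 4`. For `φ`, Markov's inequality makes this scale a multiple of
`σ_A`. The second claim follows by separating `‖ψ‖` and `‖φ‖` at a level `σ_A ^ γ` with `γ < 1`: the
supremum of `φ` rarely exceeds it, and the first estimate handles `ψ` below it. -/

/-! ### Fernique tails with universal constants -/

/-- The multiplicative constant in the uniform Gaussian tail bound. -/
noncomputable def gaussianTailConst : ℝ≥0∞ :=
  .ofReal (Real.exp (Fernique.logRatio (3 / 4)))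
    + ∑' n : ℕ, .ofReal (Real.exp
      (-2⁻¹ * Real.log ((3 / 4 : ℝ≥0∞) / (1 - 3 / 4)).toReal * 2 ^ n))

lemma three_quarters_div_one_sub : ((3 / 4 : ℝ≥0∞) / (1 - 3 / 4)).toReal = 3 := by
  rw [ENNReal.toReal_div, ENNReal.toReal_sub_of_le, ENNReal.toReal_div]
  · norm_num
  · rw [ENNReal.div_le_iff (by norm_num) (by norm_num)]
    norm_num
  · norm_num

/-- The exponents are `-(log 3 / 2) * 2 ^ n`, hence the series converges. Any threshold strictly
between `1 / 2` and `1` would serve in place of `3 / 4`. -/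
lemma gaussianTailConst_ne_top : gaussianTailConst ≠ ∞ := by
  refine (ENNReal.add_lt_top.mpr ⟨ENNReal.ofReal_lt_top, ?_⟩).ne
  refine Summable.tsum_ofReal_lt_top <|
    Real.summable_exp_nat_mul_of_ge ?_ (fun i ↦ mod_cast (Nat.lt_pow_self (by simp)).le)
  rw [three_quarters_div_one_sub]
  exact mul_neg_of_neg_of_pos (by simp) (Real.log_pos (by norm_num))

lemma half_lt_three_quarters : (2 : ℝ≥0∞)⁻¹ < 3 / 4 := by
  rw [ENNReal.lt_div_iff_mul_lt (by norm_num) (by norm_num),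
    show (4 : ℝ≥0∞) = 2 * 2 by norm_num, ← mul_assoc, ENNReal.inv_mul_cancel (by norm_num) (by norm_num)]
  norm_num

lemma logRatio_three_quarters_pos : 0 < Fernique.logRatio (3 / 4) := by
  refine Fernique.logRatio_pos half_lt_three_quarters ?_
  rw [ENNReal.div_lt_iff (by norm_num) (by norm_num)]
  norm_num

section

variable {Ω V ι : Type*} [MeasurableSpace Ω] {P : Measure Ω}
  [NormedAddCommGroup V] [NormedSpace ℝ V] [MeasurableSpace V] [BorelSpace V] {X : ι → Ω → V}

/-- Markov's inequality applied to Fernique's exponential moment bound. -/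
lemma IsGaussian.measure_norm_gt_le [CompleteSpace V] [SecondCountableTopology V]
    (μ : Measure V) [IsGaussian μ] (hμ : ∀ L : StrongDual ℝ V, ∫ x, L x ∂μ = 0)
    {a r : ℝ} (ha : 0 < a) (hr : 0 ≤ r) (h : 3 / 4 ≤ μ {x | ‖x‖ ≤ a}) :
    μ {x | a * r < ‖x‖} ≤
      gaussianTailConst * .ofReal (Real.exp (-(Fernique.logRatio (3 / 4) * r ^ 2))) := by
  set c := Fernique.logRatio (3 / 4) with hc
  have hc0 : 0 < c := logRatio_three_quarters_pos
  -- Centring makes the product of `μ` with itself rotation invariant, which is what Fernique's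
  -- argument uses.
  have hint := lintegral_exp_mul_sq_norm_le_of_map_rotation_eq_self
    (IsGaussian.map_rotation_eq_self_of_forall_strongDual_eq_zero hμ _) h half_lt_three_quarters
  have hmark := mul_meas_ge_le_lintegral₀ (μ := μ)
    (f := fun x : V => ENNReal.ofReal (Real.exp (c * a⁻¹ ^ 2 * ‖x‖ ^ 2)))
    (by fun_prop) (ENNReal.ofReal (Real.exp (c * r ^ 2)))
  have hsub : {x : V | a * r < ‖x‖} ⊆ {x | ENNReal.ofReal (Real.exp (c * r ^ 2)) ≤
      ENNReal.ofReal (Real.exp (c * a⁻¹ ^ 2 * ‖x‖ ^ 2))} := by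
    intro x hx
    have hx' : a * r < ‖x‖ := hx
    simp only [Set.mem_ofPred_eq]
    refine ENNReal.ofReal_le_ofReal (Real.exp_le_exp.2 ?_)
    rw [mul_assoc, ← mul_pow]
    gcongr
    rw [inv_mul_eq_div, le_div_iff₀ ha]
    linarith
  rw [Real.exp_neg, ENNReal.ofReal_inv_of_pos (Real.exp_pos _), ← div_eq_mul_inv,
    ENNReal.le_div_iff_mul_le (Or.inl (by simp [Real.exp_pos])) (Or.inl ENNReal.ofReal_ne_top),
    mul_comm]
  calc _ ≤ _ := mul_le_mul_right (measure_mono hsub) _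
    _ ≤ _ := hmark
    _ ≤ _ := hint

/-- A uniform tail bound for the supremum of a countable centred Gaussian family: its scale is
any `a` that bounds the family with probability at least `3 / 4`. -/
theorem IsGaussianProcess.measure_exists_norm_gt_le [FiniteDimensional ℝ V] [Countable ι]
    (hX : IsGaussianProcess X P)
    (hX0 : ∀ i, ∫ ω, X i ω ∂P = 0) {a r : ℝ} (ha : 0 < a) (hr : 0 ≤ r)
    (h : 3 / 4 ≤ P {ω | ∀ i, ‖X i ω‖ ≤ a}) :
    P {ω | ∃ i, a * r < ‖X i ω‖} ≤
      gaussianTailConst * .ofReal (Real.exp (-(Fernique.logRatio (3 / 4) * r ^ 2))) := by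
  have : CompleteSpace V := FiniteDimensional.complete ℝ V
  have : SecondCountableTopology V :=
    have := FiniteDimensional.proper ℝ V; inferInstance
  have hU : {ω | ∃ i, a * r < ‖X i ω‖} =
      ⋃ I : Finset ι, {ω | ∃ i ∈ I, a * r < ‖X i ω‖} := by
    ext ω
    simp only [Set.mem_ofPred_eq, Set.mem_iUnion]
    exact ⟨fun ⟨i, hi⟩ => ⟨{i}, i, by simp, hi⟩, fun ⟨_, i, _, hi⟩ => ⟨i, hi⟩⟩
  have hmono : Monotone fun I : Finset ι => {ω | ∃ i ∈ I, a * r < ‖X i ω‖} :=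
    fun I J hIJ ω ⟨i, hi, h⟩ => ⟨i, hIJ hi, h⟩
  -- Continuity from below reduces to finite subfamilies. The bound does not depend on the
  -- subfamily, and the sup norm on `I → V` turns the family into one Gaussian vector.
  rw [hU, hmono.directed_le.measure_iUnion]
  refine iSup_le fun I => ?_
  have hlaw := hX.hasGaussianLaw I
  have hae := hlaw.aemeasurable
  set Y : Ω → I → V := fun ω => I.restrict (X · ω) with hY
  have : IsGaussian (P.map Y) := hlaw.isGaussian_map
  have hint := hlaw.integrable
  have hL : ∀ L : StrongDual ℝ (I → V), ∫ x, L x ∂(P.map Y) = 0 := by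
    intro L
    rw [integral_map hae (by fun_prop), L.integral_comp_comm hint]
    have : ∫ ω, Y ω ∂P = 0 := by
      funext i
      rw [eval_integral (fun i => hint.eval i)]
      exact hX0 i
    rw [this, map_zero]
  have key := IsGaussian.measure_norm_gt_le (P.map Y) hL ha hr ?_
  · rw [Measure.map_apply_of_aemeasurable hae
      (measurableSet_lt measurable_const measurable_norm)] at key
    refine (measure_mono ?_).trans key
    rintro ω ⟨i, hi, h⟩
    exact h.trans_le (norm_le_pi_norm (Y ω) ⟨i, hi⟩)
  · rw [Measure.map_apply_of_aemeasurable hae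
      (measurableSet_le measurable_norm measurable_const)]
    refine h.trans (measure_mono fun ω hω => ?_)
    exact (pi_norm_le_iff_of_nonneg ha.le).2 fun i => hω i

/-- Since `2 r ≤ r ^ 2 + 1`, the Gaussian factor is at most `exp c * exp (-2 c r)`; one term of the
exponential series then bounds it by a power. -/
lemma exists_exp_neg_sq_le_rpow (k : ℕ) : ∃ K : ℝ, 0 < K ∧ ∀ r : ℝ, 0 < r →
    Real.exp (-(Fernique.logRatio (3 / 4) * r ^ 2)) ≤ K * (r ^ k)⁻¹ := by
  have hc := logRatio_three_quarters_pos
  set c := Fernique.logRatio (3 / 4)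
  refine ⟨Real.exp c * (k.factorial / (2 * c) ^ k), by positivity, fun r hr => ?_⟩
  have h1 : (2 * c * r) ^ k / k.factorial ≤ Real.exp (2 * c * r) :=
    Real.pow_div_factorial_le_exp _ (by positivity) k
  have h2 : Real.exp (-(c * r ^ 2)) ≤ Real.exp c * (Real.exp (2 * c * r))⁻¹ := by
    rw [← Real.exp_neg, ← Real.exp_add, Real.exp_le_exp]
    nlinarith [mul_nonneg hc.le (sq_nonneg (r - 1))]
  have h3 : (Real.exp (2 * c * r))⁻¹ ≤ ((2 * c * r) ^ k / k.factorial)⁻¹ :=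
    inv_anti₀ (by positivity) h1
  refine h2.trans ((mul_le_mul_of_nonneg_left h3 (Real.exp_pos c).le).trans (le_of_eq ?_))
  rw [mul_pow]
  field_simp

/-- The constant in the polynomial Gaussian tail bound of order `k`. -/
noncomputable def gaussianTailPowConst (k : ℕ) : ℝ :=
  gaussianTailConst.toReal * (exists_exp_neg_sq_le_rpow k).choose

lemma gaussianTailPowConst_nonneg (k : ℕ) : 0 ≤ gaussianTailPowConst k :=
  mul_nonneg ENNReal.toReal_nonneg (exists_exp_neg_sq_le_rpow k).choose_spec.1.le

/-- Polynomial version of the uniform tail bound for a countable centred Gaussian family. -/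
theorem IsGaussianProcess.measureReal_exists_norm_gt_le [FiniteDimensional ℝ V] [Countable ι]
    (hX : IsGaussianProcess X P) (hX0 : ∀ i, ∫ ω, X i ω ∂P = 0) {a r : ℝ} (ha : 0 < a)
    (hr : 0 < r) (h : 3 / 4 ≤ P {ω | ∀ i, ‖X i ω‖ ≤ a}) (k : ℕ) :
    P.real {ω | ∃ i, a * r < ‖X i ω‖} ≤ gaussianTailPowConst k * (r ^ k)⁻¹ := by
  have h1 := measure_exists_norm_gt_le hX hX0 ha hr.le h
  have h2 := ENNReal.toReal_mono
    (ENNReal.mul_ne_top gaussianTailConst_ne_top ENNReal.ofReal_ne_top) h1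
  rw [ENNReal.toReal_mul, ENNReal.toReal_ofReal (Real.exp_pos _).le] at h2
  refine h2.trans ?_
  rw [gaussianTailPowConst, mul_assoc]
  exact mul_le_mul_of_nonneg_left ((exists_exp_neg_sq_le_rpow k).choose_spec.2 r hr)
    ENNReal.toReal_nonneg

/-- The supremum of a countable, almost surely bounded, centred Gaussian family has polynomial
tails of every order. -/
theorem IsGaussianProcess.exists_measureReal_exists_norm_gt_le [FiniteDimensional ℝ V]
    [Countable ι] [IsProbabilityMeasure P]
    (hX : IsGaussianProcess X P) (hX0 : ∀ i, ∫ ω, X i ω ∂P = 0)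
    (hb : ∀ᵐ ω ∂P, ∃ C : ℝ, ∀ i, ‖X i ω‖ ≤ C) (k : ℕ) :
    ∃ K : ℝ, 0 ≤ K ∧ ∀ R : ℝ, 0 < R → P.real {ω | ∃ i, R < ‖X i ω‖} ≤ K * (R ^ k)⁻¹ := by
  have hmono : Monotone fun n : ℕ => {ω | ∀ i, ‖X i ω‖ ≤ n} :=
    fun m n hmn ω hω i => (hω i).trans (by exact_mod_cast hmn)
  have hU : P (⋃ n : ℕ, {ω | ∀ i, ‖X i ω‖ ≤ n}) = 1 := by
    rw [measure_congr (ae_eq_univ.2 ?_), measure_univ]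
    rw [← mem_ae_iff]
    filter_upwards [hb] with ω ⟨C, hC⟩
    obtain ⟨n, hn⟩ := exists_nat_ge C
    exact Set.mem_iUnion.2 ⟨n, fun i => (hC i).trans hn⟩
  have hlim := tendsto_measure_iUnion_atTop (μ := P) hmono
  rw [hU] at hlim
  have hlt : (3 / 4 : ℝ≥0∞) < 1 := by
    rw [ENNReal.div_lt_iff (by norm_num) (by norm_num)]
    norm_num
  -- Almost sure boundedness supplies some scale `n` of probability above `3 / 4`.
  obtain ⟨n, hn, hn0⟩ := ((hlim.eventually (lt_mem_nhds hlt)).and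
    (Filter.eventually_gt_atTop 0)).exists
  have ha : (0 : ℝ) < n := by exact_mod_cast hn0
  refine ⟨gaussianTailPowConst k * (n : ℝ) ^ k,
    mul_nonneg (gaussianTailPowConst_nonneg k) (by positivity), fun R hR => ?_⟩
  have := measureReal_exists_norm_gt_le hX hX0 ha (div_pos hR ha) hn.le k
  rw [mul_div_cancel₀ _ ha.ne'] at this
  refine this.trans (le_of_eq ?_)
  rw [div_pow, inv_div, mul_assoc, div_eq_mul_inv]

end

/-! ### Domination of Gaussian laws by `N(0, s² I)` -/

section

variable {H : Type*} [NormedAddCommGroup H] [InnerProductSpace ℝ H] [FiniteDimensional ℝ H]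
  [MeasurableSpace H] [BorelSpace H]

variable (H) in
/-- The standard Gaussian measure has a density proportional to `exp (-‖x‖ ^ 2 / 2)`. -/
theorem exists_stdGaussian_eq_withDensity : ∃ c : ℝ, 0 < c ∧
    stdGaussian H = (volume : Measure H).withDensity
      (fun x => ENNReal.ofReal (c * Real.exp (-(1 / 2) * ‖x‖ ^ 2))) := by
  have hb : (0 : ℝ) < 1 / 2 := by norm_num
  set Z : ℝ := ∫ v : H, Real.exp (-(1 / 2) * ‖v‖ ^ 2) with hZ
  have hZval := GaussianFourier.integral_rexp_neg_mul_sq_norm (V := H) hb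
  have hZpos : 0 < Z := by
    rw [hZ, hZval]
    positivity
  have hint : Integrable (fun v : H => Real.exp (-(1 / 2) * ‖v‖ ^ 2)) :=
    Integrable.of_integral_ne_zero hZpos.ne'
  have hfin : IsFiniteMeasure ((volume : Measure H).withDensity
      (fun x => ENNReal.ofReal (Z⁻¹ * Real.exp (-(1 / 2) * ‖x‖ ^ 2)))) :=
    isFiniteMeasure_withDensity_ofReal (hint.const_mul _).2
  refine ⟨Z⁻¹, inv_pos.2 hZpos, Measure.ext_of_charFun (funext fun t => ?_)⟩
  rw [charFun_stdGaussian, charFun_apply, integral_withDensity_eq_integral_toReal_smul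
    (by fun_prop) (by simp)]
  have h1 := GaussianFourier.integral_cexp_neg_mul_sq_norm_add (V := H)
    (b := (1 / 2 : ℝ)) (by simp) Complex.I t
  have h2 := GaussianFourier.integral_cexp_neg_mul_sq_norm (V := H)
    (b := (1 / 2 : ℝ)) (by simp)
  have h3 : ∫ v : H, Complex.exp (-((1 / 2 : ℝ) : ℂ) * ‖v‖ ^ 2) = (Z : ℂ) := by
    rw [hZ, ← integral_complex_ofReal]
    congr 1 with v
    push_cast
    rfl
  rw [h3] at h2
  rw [← h2] at h1
  have hZc : (Z : ℂ) ≠ 0 := by exact_mod_cast hZpos.ne'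
  calc Complex.exp (-(‖t‖ : ℂ) ^ 2 / 2)
      = (Z : ℂ)⁻¹ * ((Z : ℂ) * Complex.exp
        (Complex.I ^ 2 * ‖t‖ ^ 2 / (4 * ((1 / 2 : ℝ) : ℂ)))) := by
        rw [inv_mul_cancel_left₀ hZc]
        congr 1
        rw [Complex.I_sq]
        push_cast
        ring
    _ = _ := by
        rw [← h1, ← integral_const_mul]
        congr 1 with v
        rw [ENNReal.toReal_ofReal (by positivity), Complex.exp_add, Complex.real_smul,
          real_inner_comm]
        push_cast
        rw [mul_assoc, mul_comm Complex.I]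

lemma stdGaussian_closedBall_pos : 0 < stdGaussian H (Metric.closedBall 0 1) := by
  obtain ⟨c, hc, h⟩ := exists_stdGaussian_eq_withDensity H
  rw [pos_iff_ne_zero, h, Ne, withDensity_apply_eq_zero (by fun_prop)]
  have : {x : H | ENNReal.ofReal (c * Real.exp (-(1 / 2) * ‖x‖ ^ 2)) ≠ 0} = Set.univ := by
    ext x
    simp only [Set.mem_ofPred_eq, Set.mem_univ, iff_true, Ne, ENNReal.ofReal_eq_zero, not_le]
    positivity
  rw [this, Set.univ_inter]
  exact (Metric.measure_closedBall_pos _ _ one_pos).ne'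

/-- A linear image `T` of the standard Gaussian measure with `‖T‖ ≤ s` is dominated by its
dilation by `s`, up to the ratio of the determinants. -/
lemma stdGaussian_map_le_of_det_ne_zero (T : H →L[ℝ] H) {s : ℝ} (hs : 0 < s)
    (hT : ∀ x, ‖T x‖ ≤ s * ‖x‖) (hdet : LinearMap.det (T : H →ₗ[ℝ] H) ≠ 0) {S : Set H}
    (hS : MeasurableSet S) :
    (stdGaussian H).map T S ≤ ENNReal.ofReal |(LinearMap.det (T : H →ₗ[ℝ] H))⁻¹| *
      ENNReal.ofReal (s ^ Module.finrank ℝ H) * (stdGaussian H).map (fun y => s • y) S := by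
  obtain ⟨c, hc, h⟩ := exists_stdGaussian_eq_withDensity H
  set f : H → ℝ≥0∞ := fun x => ENNReal.ofReal (c * Real.exp (-(1 / 2) * ‖x‖ ^ 2)) with hf
  have hfm : Measurable f := by fun_prop
  have hTm : Measurable T := T.continuous.measurable
  have hsm : Measurable fun y : H => s • y := measurable_const_smul s
  have hmapT : (volume : Measure H).map T =
      ENNReal.ofReal |(LinearMap.det (T : H →ₗ[ℝ] H))⁻¹| • volume :=
    Measure.map_linearMap_addHaar_eq_smul_addHaar volume hdet
  have hmaps : (volume : Measure H).map (fun y => s • y) =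
      ENNReal.ofReal |(s ^ Module.finrank ℝ H)⁻¹| • volume :=
    Measure.map_addHaar_smul volume hs.ne'
  have hTS : (stdGaussian H).map T S ≤
      ENNReal.ofReal |(LinearMap.det (T : H →ₗ[ℝ] H))⁻¹| * ∫⁻ y in S, f (s⁻¹ • y) := by
    rw [Measure.map_apply hTm hS, h, withDensity_apply _ (hTm hS), ← smul_eq_mul,
      ← lintegral_smul_measure,
      ← Measure.restrict_smul, ← hmapT, setLIntegral_map hS (by fun_prop) hTm]
    -- After the change of variables it remains to compare densities: `‖s⁻¹ • T x‖ ≤ ‖x‖`, and the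
    -- density decreases with the norm.
    refine lintegral_mono fun x => ENNReal.ofReal_le_ofReal ?_
    gcongr ?_ * Real.exp ?_
    have : ‖s⁻¹ • T x‖ ≤ ‖x‖ := by
      rw [norm_smul, norm_inv, Real.norm_of_nonneg hs.le, inv_mul_le_iff₀ hs]
      exact hT x
    nlinarith [norm_nonneg (s⁻¹ • T x)]
  have hsS : (stdGaussian H).map (fun y => s • y) S =
      ENNReal.ofReal |(s ^ Module.finrank ℝ H)⁻¹| * ∫⁻ y in S, f (s⁻¹ • y) := by
    rw [Measure.map_apply hsm hS, h, withDensity_apply _ (hsm hS), ← smul_eq_mul,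
      ← lintegral_smul_measure,
      ← Measure.restrict_smul, ← hmaps, setLIntegral_map hS (by fun_prop) hsm]
    simp [inv_smul_smul₀ hs.ne', hf]
  refine hTS.trans (le_of_eq ?_)
  have hp : 0 < s ^ Module.finrank ℝ H := by positivity
  rw [hsS, mul_assoc, ← mul_assoc (ENNReal.ofReal (s ^ Module.finrank ℝ H)),
    ← ENNReal.ofReal_mul hp.le, abs_of_pos (inv_pos.2 hp), mul_inv_cancel₀ hp.ne',
    ENNReal.ofReal_one, one_mul]

/-- The domination constant for Gaussian measures with density bounded by `C`. -/
noncomputable def gaussianDominationConst (H : Type*) [NormedAddCommGroup H]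
    [InnerProductSpace ℝ H] [FiniteDimensional ℝ H] [MeasurableSpace H] [BorelSpace H]
    (C : ℝ≥0∞) (s : ℝ) : ℝ≥0∞ :=
  C * volume (Metric.closedBall (0 : H) 1) / stdGaussian H (Metric.closedBall 0 1) *
    ENNReal.ofReal (s ^ Module.finrank ℝ H)

lemma gaussianDominationConst_ne_top {C : ℝ≥0∞} (hC : C ≠ ∞) (s : ℝ) :
    gaussianDominationConst H C s ≠ ∞ :=
  ENNReal.mul_ne_top (ENNReal.div_ne_top
    (ENNReal.mul_ne_top hC measure_closedBall_lt_top.ne) stdGaussian_closedBall_pos.ne')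
    ENNReal.ofReal_ne_top

/-- Testing the density bound on the image of the unit ball gives a lower bound for `|det T|`. This
removes the determinant from the previous estimate and excludes degenerate `T`. -/
lemma stdGaussian_map_le (T : H →L[ℝ] H) {s : ℝ} (hs : 0 < s) (hT : ∀ x, ‖T x‖ ≤ s * ‖x‖)
    {C : ℝ≥0∞} (hd : ∀ S, MeasurableSet S → (stdGaussian H).map T S ≤ C * volume S) {S : Set H}
    (hS : MeasurableSet S) :
    (stdGaussian H).map T S ≤
      gaussianDominationConst H C s * (stdGaussian H).map (fun y => s • y) S := by
  set D := LinearMap.det (T : H →ₗ[ℝ] H) with hD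
  set B := Metric.closedBall (0 : H) 1
  have hB : stdGaussian H B ≤ C * (ENNReal.ofReal |D| * volume B) := by
    have hm : MeasurableSet (T '' B) :=
      ((isCompact_closedBall _ _).image T.continuous).isClosed.measurableSet
    have := hd _ hm
    rw [Measure.map_apply T.continuous.measurable hm,
      Measure.addHaar_image_continuousLinearMap] at this
    exact (measure_mono (Set.subset_preimage_image T B)).trans this
  have hD0 : D ≠ 0 := by
    intro h0
    rw [h0] at hB
    simp only [abs_zero, ENNReal.ofReal_zero, zero_mul, mul_zero, nonpos_iff_eq_zero] at hB
    exact stdGaussian_closedBall_pos.ne' hB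
  refine (stdGaussian_map_le_of_det_ne_zero T hs hT hD0 hS).trans ?_
  rw [gaussianDominationConst]
  gcongr
  rw [ENNReal.le_div_iff_mul_le (Or.inl stdGaussian_closedBall_pos.ne')
    (Or.inl (measure_ne_top _ _))]
  refine (mul_le_mul_right hB _).trans (le_of_eq ?_)
  have : ENNReal.ofReal |D⁻¹| * ENNReal.ofReal |D| = 1 := by
    rw [← ENNReal.ofReal_mul (abs_nonneg _), ← abs_mul, inv_mul_cancel₀ hD0]
    simp
  calc _ = (ENNReal.ofReal |D⁻¹| * ENNReal.ofReal |D|) * (C * volume B) := by ring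
    _ = _ := by rw [this, one_mul]

/-- A centred Gaussian measure on a finite-dimensional inner product space is the image of the
standard one under a linear map whose norm is controlled by the covariance. -/
theorem exists_map_stdGaussian_eq (μ : Measure H) [IsGaussian μ] (hμ : ∫ x, x ∂μ = 0) {s : ℝ}
    (hs : 0 < s) (hcov : ∀ v : H, ∫ x, inner ℝ v x ^ 2 ∂μ ≤ s ^ 2 * ‖v‖ ^ 2) :
    ∃ T : H →L[ℝ] H, (∀ x, ‖T x‖ ≤ s * ‖x‖) ∧ μ = (stdGaussian H).map T := by
  have hL2 : MemLp id 2 μ := IsGaussian.memLp_two_id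
  set A := covarianceOperator μ with hA
  have hpos : (A : H →ₗ[ℝ] H).IsPositive := isPositive_covarianceOperator
  have hsym := hpos.isSymmetric
  set b := hsym.eigenvectorBasis rfl
  set l := hsym.eigenvalues rfl
  have hAb : ∀ i, A (b i) = l i • b i := fun i => hsym.apply_eigenvectorBasis rfl i
  have hl : ∀ i, l i = ∫ x, inner ℝ (b i) x ^ 2 ∂μ := fun i => by
    have := covarianceOperator_inner hL2 (b i) (b i)
    rw [← hA, hAb, inner_smul_left, real_inner_self_eq_norm_sq, b.norm_eq_one] at this
    simpa [pow_two] using this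
  have hl0 : ∀ i, 0 ≤ l i := fun i => by
    rw [hl]
    exact integral_nonneg fun x => sq_nonneg _
  have hls : ∀ i, l i ≤ s ^ 2 := fun i => by
    rw [hl]
    simpa using hcov (b i)
  -- `T` is the positive square root of the covariance operator, written in an eigenbasis.
  let T : H →L[ℝ] H := ∑ i, √(l i) • (innerSL ℝ (b i)).smulRight (b i)
  have hTx : ∀ x, T x = ∑ i, (√(l i) * inner ℝ (b i) x) • b i := fun x => by
    simp [T, smul_smul]
  have hbT : ∀ i x, inner ℝ (b i) (T x) = √(l i) * inner ℝ (b i) x := fun i x => by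
    rw [hTx, b.orthonormal.inner_right_fintype]
  have hTT : ∀ x y, inner ℝ (T x) (T y) = inner ℝ (A x) y := fun x y => by
    rw [← b.sum_inner_mul_inner (A x) y, ← b.sum_inner_mul_inner (T x) (T y)]
    refine Finset.sum_congr rfl fun i _ => ?_
    have hAx : inner ℝ (A x) (b i) = l i * inner ℝ x (b i) := by
      have := hsym x (b i)
      simp only [ContinuousLinearMap.coe_coe] at this
      rw [this, hAb, inner_smul_right]
    rw [real_inner_comm, hbT, hbT, hAx, real_inner_comm]
    have := Real.mul_self_sqrt (hl0 i)
    linear_combination (inner ℝ x (b i) * inner ℝ (b i) y) * this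
  have hTad : ContinuousLinearMap.adjoint T = T := by
    refine ((ContinuousLinearMap.eq_adjoint_iff T T).2 fun x y => ?_).symm
    rw [← b.sum_inner_mul_inner (T x) y, ← b.sum_inner_mul_inner x (T y)]
    refine Finset.sum_congr rfl fun i _ => ?_
    rw [real_inner_comm, hbT, hbT, real_inner_comm]
    ring
  refine ⟨T, fun x => ?_, ?_⟩
  · refine abs_le_of_sq_le_sq' ?_ (by positivity) |>.2
    rw [mul_pow, ← b.sum_sq_inner_right, ← b.sum_sq_inner_right x, Finset.mul_sum]
    refine Finset.sum_le_sum fun i _ => ?_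
    rw [hbT, mul_pow, Real.sq_sqrt (hl0 i)]
    exact mul_le_mul_of_nonneg_right (hls i) (sq_nonneg _)
  · have hmean : ∫ x, x ∂((stdGaussian H).map T) = 0 := by
      have := T.integral_id_map (μ := stdGaussian H) IsGaussian.integrable_id
      simpa using this
    refine IsGaussian.ext (by simpa using hμ.trans hmean.symm) ?_
    ext x y
    rw [covarianceBilin_map IsGaussian.memLp_two_id, covarianceBilin_stdGaussian, hTad,
      innerSL_apply_apply, hTT, covarianceOperator_inner hL2, covarianceBilin_apply hL2]
    simp [hμ]

/-- A centred Gaussian measure with density bounded by `C` and covariance bounded by `s ^ 2` is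
dominated by a multiple of the Gaussian measure with covariance `s ^ 2`. -/
theorem IsGaussian.le_gaussianDominationConst_mul (μ : Measure H) [IsGaussian μ]
    (hμ : ∫ x, x ∂μ = 0) {s : ℝ} (hs : 0 < s)
    (hcov : ∀ v : H, ∫ x, inner ℝ v x ^ 2 ∂μ ≤ s ^ 2 * ‖v‖ ^ 2) {C : ℝ≥0∞}
    (hd : ∀ S, MeasurableSet S → μ S ≤ C * volume S) {S : Set H} (hS : MeasurableSet S) :
    μ S ≤ gaussianDominationConst H C s * (stdGaussian H).map (fun y => s • y) S := by
  obtain ⟨T, hT, rfl⟩ := exists_map_stdGaussian_eq μ hμ hs hcov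
  exact stdGaussian_map_le T hs hT hd hS

end

/-! ### Small ball probabilities at a fixed point -/

lemma HasDensityBoundedOn.measure_le {E : Type*} [MeasureSpace E] {μ : Measure E} {s : Set E}
    {C : ℝ≥0} (h : HasDensityBoundedOn μ s C) {S : Set E} (hS : MeasurableSet S) (hSs : S ⊆ s) :
    μ S ≤ C * volume S := by
  obtain ⟨f, hf, hfC, hμ⟩ := h
  have h1 : μ S = ∫⁻ x in S, f x := by
    have := congrArg (fun ν : Measure E => ν S) hμ
    simp only [withDensity_apply _ hS, Measure.restrict_apply hS, Measure.restrict_restrict hS,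
      Set.inter_eq_left.2 hSs] at this
    exact this
  rw [h1]
  calc ∫⁻ x in S, f x ≤ ∫⁻ _ in S, (C : ℝ≥0∞) :=
        setLIntegral_mono measurable_const fun x hx => hfC x (hSs hx)
    _ = C * volume S := setLIntegral_const _ _

/-- A real random variable with a bounded density near `0` has small ball probabilities of
linear order. -/
lemma HasDensityBoundedOn.exists_measure_Icc_le {μ : Measure ℝ} [IsProbabilityMeasure μ]
    {ε : ℝ} (hε : 0 < ε) {C : ℝ≥0} (h : HasDensityBoundedOn μ (Set.Icc (-ε) ε) C) :
    ∃ K : ℝ, 0 ≤ K ∧ ∀ θ : ℝ, 0 ≤ θ → μ (Set.Icc (-θ) θ) ≤ ENNReal.ofReal (K * θ) := by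
  -- `2 * C` serves for `θ ≤ ε`; for `θ > ε` the summand `ε⁻¹` makes the bound exceed `1`.
  refine ⟨2 * C + ε⁻¹, by positivity, fun θ hθ => ?_⟩
  rcases le_or_gt θ ε with hle | hlt
  · refine (h.measure_le measurableSet_Icc
      (Set.Icc_subset_Icc (neg_le_neg hle) hle)).trans ?_
    rw [Real.volume_Icc, ← ENNReal.ofReal_coe_nnreal, ← ENNReal.ofReal_mul C.coe_nonneg]
    refine ENNReal.ofReal_le_ofReal ?_
    have : 0 ≤ ε⁻¹ * θ := by positivity
    linarith
  · refine prob_le_one.trans ?_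
    rw [← ENNReal.ofReal_one]
    refine ENNReal.ofReal_le_ofReal ?_
    have h1 : 1 ≤ ε⁻¹ * θ := by
      rw [inv_mul_eq_div, one_le_div hε]
      exact hlt.le
    have : 0 ≤ 2 * C * θ := by positivity
    linarith

section

variable {ι : Type*} [Fintype ι] {E : ι → Type*} [∀ i, NormedAddCommGroup (E i)]
  [∀ i, InnerProductSpace ℝ (E i)] [∀ i, FiniteDimensional ℝ (E i)]
  [∀ i, MeasurableSpace (E i)] [∀ i, BorelSpace (E i)]

lemma map_toLp_pi_stdGaussian :
    (Measure.pi fun i => stdGaussian (E i)).map (WithLp.toLp 2) = stdGaussian (PiLp 2 E) := by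
  have : ∀ i, SecondCountableTopology (E i) := fun i => by
    have := FiniteDimensional.proper ℝ (E i)
    infer_instance
  have : ∀ i, CompleteSpace (E i) := fun i => FiniteDimensional.complete ℝ (E i)
  apply Measure.ext_of_charFun
  ext t
  simp_rw [charFun_pi, charFun_stdGaussian, ← Complex.exp_sum, ← Complex.ofReal_pow,
    PiLp.norm_sq_eq_of_L2]
  simp [Finset.sum_div, neg_div]

-- Both are Haar measures. The sup norm and Euclidean versions of the product may thus be exchanged
-- at the cost of a constant whose value is irrelevant.
variable (E) in
lemma exists_map_toLp_volume_eq_smul : ∃ c : ℝ≥0,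
    (volume : Measure ((i : ι) → E i)).map (WithLp.toLp 2) =
      (c : ℝ≥0∞) • (volume : Measure (PiLp 2 E)) := by
  have : ∀ i, SecondCountableTopology (E i) := fun i => by
    have := FiniteDimensional.proper ℝ (E i)
    infer_instance
  let e := (PiLp.continuousLinearEquiv 2 ℝ E).symm
  have h : Measure.IsAddHaarMeasure ((volume : Measure ((i : ι) → E i)).map e) :=
    e.isAddHaarMeasure_map _
  refine ⟨_, Measure.isAddLeftInvariant_eq_smul
    ((volume : Measure ((i : ι) → E i)).map e) (volume : Measure (PiLp 2 E))⟩

/-- A centred Gaussian vector in a product space with bounded density and bounded covariance is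
dominated by independent Gaussian vectors. -/
theorem exists_gaussian_pi_domination (C : ℝ≥0) {s : ℝ} (hs : 0 < s) : ∃ K : ℝ≥0,
    ∀ (μ : Measure ((i : ι) → E i)), IsGaussian μ → (∫ x, x ∂μ = 0) →
      (∀ v : (i : ι) → E i, ∫ x, (∑ i, inner ℝ (v i) (x i)) ^ 2 ∂μ ≤ s ^ 2 * ∑ i, ‖v i‖ ^ 2) →
      HasDensityBoundedOn μ Set.univ C → ∀ S, MeasurableSet S →
        μ S ≤ K * (Measure.pi fun i => stdGaussian (E i)) {y | s • y ∈ S} := by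
  have : ∀ i, SecondCountableTopology (E i) := fun i => by
    have := FiniteDimensional.proper ℝ (E i)
    infer_instance
  obtain ⟨c, hc⟩ := exists_map_toLp_volume_eq_smul E
  have hne : gaussianDominationConst (PiLp 2 E) (C * c) s ≠ ∞ :=
    gaussianDominationConst_ne_top (by finiteness) s
  refine ⟨(gaussianDominationConst (PiLp 2 E) (C * c) s).toNNReal,
    fun μ hμ hμ0 hcov hd S hS => ?_⟩
  rw [ENNReal.coe_toNNReal hne]
  let e := (PiLp.continuousLinearEquiv 2 ℝ E).symm
  have he : ⇑e = WithLp.toLp 2 := rfl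
  have hem : Measurable (WithLp.toLp 2 : ((i : ι) → E i) → PiLp 2 E) := by fun_prop
  have hgm : IsGaussian (μ.map (WithLp.toLp 2 : ((i : ι) → E i) → PiLp 2 E)) := by
    have : IsGaussian (μ.map (e : ((i : ι) → E i) →L[ℝ] PiLp 2 E)) := inferInstance
    exact this
  have hT : MeasurableSet (WithLp.ofLp (p := 2) ⁻¹' S : Set (PiLp 2 E)) :=
    (by fun_prop : Measurable (WithLp.ofLp : PiLp 2 E → (i : ι) → E i)) hS
  have key := IsGaussian.le_gaussianDominationConst_mul
    (μ.map (WithLp.toLp 2 : ((i : ι) → E i) → PiLp 2 E)) ?_ hs ?_ (C := C * c) ?_ hT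
  · rw [Measure.map_apply hem hT, ← map_toLp_pi_stdGaussian,
      Measure.map_map (measurable_const_smul s) hem,
      Measure.map_apply ((measurable_const_smul s).comp hem) hT] at key
    exact key
  · have := (e : ((i : ι) → E i) →L[ℝ] PiLp 2 E).integral_id_map (μ := μ) IsGaussian.integrable_id
    rw [show (μ.map (WithLp.toLp 2 : ((i : ι) → E i) → PiLp 2 E)) =
      μ.map (e : ((i : ι) → E i) →L[ℝ] PiLp 2 E) from rfl, this, hμ0, map_zero]
  · intro v
    rw [integral_map hem.aemeasurable (by fun_prop)]
    simpa [PiLp.inner_apply, PiLp.norm_sq_eq_of_L2] using hcov v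
  · intro B hB
    rw [Measure.map_apply hem hB]
    refine (hd.measure_le (hem hB) (Set.subset_univ _)).trans (le_of_eq ?_)
    rw [← Measure.map_apply hem hB, hc, Measure.smul_apply, smul_eq_mul, mul_assoc]

end

/-- Small ball estimate for `(h 1 (G 1), …, h p (G p))`, uniform over the Gaussian vectors `G`
with prescribed bounds on their density and covariance. -/
theorem exists_measureReal_forall_abs_le_le {p : ℕ} {d : Fin p → ℕ} (C : ℝ≥0) {s : ℝ}
    (hs : 0 < s) (h : (i : Fin p) → EuclideanSpace ℝ (Fin (d i)) → ℝ)
    (hh : ∀ i, Measurable (h i))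
    (hdens : ∀ i, ∃ ε : ℝ, 0 < ε ∧ ∃ C : ℝ≥0,
      HasDensityBoundedOn
        ((stdGaussian (EuclideanSpace ℝ (Fin (d i)))).map (fun y => h i (s • y)))
        (Set.Icc (-ε) ε) C) :
    ∃ K : ℝ, 0 ≤ K ∧ ∀ {Ω : Type*} [MeasurableSpace Ω] (P : Measure Ω) [IsProbabilityMeasure P]
      (G : Ω → (i : Fin p) → EuclideanSpace ℝ (Fin (d i))), HasGaussianLaw G P →
      (∀ i, ∫ ω, G ω i ∂P = 0) →
      (∀ v : (i : Fin p) → EuclideanSpace ℝ (Fin (d i)),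
        ∫ ω, (∑ i, inner ℝ (v i) (G ω i)) ^ 2 ∂P ≤ s ^ 2 * ∑ i, ‖v i‖ ^ 2) →
      HasDensityBoundedOn (P.map G) Set.univ C →
      ∀ θ : ℝ, 0 ≤ θ → P.real {ω | ∀ i, |h i (G ω i)| ≤ θ} ≤ K * θ ^ p := by
  choose ε hε C' hC' using hdens
  have hm : ∀ i, Measurable fun y => h i (s • y) := fun i =>
    (hh i).comp (measurable_const_smul s)
  have hprob : ∀ i, IsProbabilityMeasure
      ((stdGaussian (EuclideanSpace ℝ (Fin (d i)))).map (fun y => h i (s • y))) :=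
    fun i => Measure.isProbabilityMeasure_map (hm i).aemeasurable
  choose L hL0 hL using fun i => (hC' i).exists_measure_Icc_le (hε i)
  obtain ⟨K, hK⟩ := exists_gaussian_pi_domination
    (E := fun i : Fin p => EuclideanSpace ℝ (Fin (d i))) C hs
  have hprod : 0 ≤ ∏ i, L i := Finset.prod_nonneg fun i _ => hL0 i
  refine ⟨K * ∏ i, L i, mul_nonneg K.coe_nonneg hprod, fun P _ G hG hG0 hcov hd θ hθ => ?_⟩
  set S : Set ((i : Fin p) → EuclideanSpace ℝ (Fin (d i))) := {y | ∀ i, |h i (y i)| ≤ θ} with hS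
  have hSm : MeasurableSet S := by
    rw [hS, Set.ofPred_forall]
    exact MeasurableSet.iInter fun i => measurableSet_le
      (((hh i).comp (measurable_pi_apply i)).abs) measurable_const
  have hmean : ∫ x, x ∂(P.map G) = 0 := by
    rw [integral_map hG.aemeasurable (by fun_prop)]
    funext i
    rw [eval_integral (fun i => hG.integrable.eval i)]
    exact hG0 i
  have h1 := hK (P.map G) hG.isGaussian_map hmean (fun v => by
    rw [integral_map hG.aemeasurable (Continuous.aestronglyMeasurable (by fun_prop))]
    exact hcov v) hd S hSm
  have h2 : (Measure.pi fun i : Fin p => stdGaussian (EuclideanSpace ℝ (Fin (d i))))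
      {y | s • y ∈ S} ≤ ENNReal.ofReal ((∏ i, L i) * θ ^ p) := by
    have : {y | s • y ∈ S} = Set.univ.pi fun i => (fun y => h i (s • y)) ⁻¹' Set.Icc (-θ) θ := by
      ext y
      simp [hS, abs_le]
    rw [this, Measure.pi_pi]
    calc _ ≤ ∏ i, ENNReal.ofReal (L i * θ) := Finset.prod_le_prod' fun i _ => by
            have := hL i θ hθ
            rwa [Measure.map_apply (hm i) measurableSet_Icc] at this
      _ = _ := by
            rw [← ENNReal.ofReal_prod_of_nonneg fun i _ => mul_nonneg (hL0 i) hθ,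
              Finset.prod_mul_distrib]
            simp
  rw [Measure.map_apply_of_aemeasurable hG.aemeasurable hSm] at h1
  have h3 := h1.trans (mul_le_mul_right h2 _)
  rw [← ENNReal.ofReal_coe_nnreal, ← ENNReal.ofReal_mul K.coe_nonneg] at h3
  have h4 := ENNReal.toReal_mono ENNReal.ofReal_ne_top h3
  rw [ENNReal.toReal_ofReal (by positivity), ← mul_assoc] at h4
  exact h4

/-! ### Deterministic tools: nets, Lipschitz bounds, choice of the radius -/

/-- A bounded subset of `ℝ^m` has `δ`-nets of cardinality `O(δ^{-m})`, and the same holds uniformly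
for its subsets. -/
theorem exists_finset_net {m : ℕ} {A : Set (EuclideanSpace ℝ (Fin m))}
    (hA : Bornology.IsBounded A) : ∃ K : ℝ, 0 ≤ K ∧ ∀ D ⊆ A, ∀ δ : ℝ, 0 < δ → δ ≤ 1 →
      ∃ F : Finset (EuclideanSpace ℝ (Fin m)), (↑F : Set (EuclideanSpace ℝ (Fin m))) ⊆ D ∧
        (F.card : ℝ) ≤ K * (δ ^ m)⁻¹ ∧ ∀ x ∈ D, ∃ y ∈ F, ‖x - y‖ ≤ δ := by
  classical
  obtain ⟨r, hr0, hr⟩ := hA.exists_pos_norm_le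
  refine ⟨(2 * (r * (m + 1)) + 2) ^ m, by positivity, fun D hD δ hδ hδ1 => ?_⟩
  -- Cubes of side `η` have diameter at most `√m * η ≤ δ`; `m + 1` also covers `m = 0`.
  set η : ℝ := δ / (m + 1) with hη
  have hη0 : 0 < η := by positivity
  let cell : EuclideanSpace ℝ (Fin m) → Fin m → ℤ := fun x i => ⌊x i / η⌋
  let T : Finset (Fin m → ℤ) := Fintype.piFinset fun _ => Finset.Icc ⌊-(r / η)⌋ ⌊r / η⌋
  have hcellT : ∀ x ∈ D, cell x ∈ T := fun x hx => by
    refine Fintype.mem_piFinset.2 fun i => Finset.mem_Icc.2 ?_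
    have h1 : |x i| ≤ r := (PiLp.norm_apply_le x i).trans (hr x (hD hx))
    have h2 := abs_le.1 h1
    refine ⟨Int.floor_le_floor ?_, Int.floor_le_floor ?_⟩
    · rw [← neg_div]
      gcongr
      exact h2.1
    · gcongr
      exact h2.2
  have hcell : ∀ x y, cell x = cell y → ‖x - y‖ ≤ δ := fun x y hxy => by
    refine abs_le_of_sq_le_sq' ?_ hδ.le |>.2
    rw [EuclideanSpace.real_norm_sq_eq]
    have hi : ∀ i, (x - y) i ^ 2 ≤ η ^ 2 := fun i => by
      have h1 := Int.abs_sub_lt_one_of_floor_eq_floor (congrFun hxy i)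
      rw [← sub_div, abs_div, abs_of_pos hη0, div_lt_one hη0] at h1
      rw [← sq_abs]
      gcongr
      exact h1.le
    calc ∑ i, (x - y) i ^ 2 ≤ ∑ _i : Fin m, η ^ 2 := Finset.sum_le_sum fun i _ => hi i
      _ = m * η ^ 2 := by simp
      _ ≤ (m + 1) ^ 2 * η ^ 2 := by
        gcongr
        nlinarith [(Nat.cast_nonneg m : (0 : ℝ) ≤ m)]
      _ = δ ^ 2 := by
        rw [hη]
        field_simp
  -- Only cells meeting `D` are kept, so that the representatives lie in `D` itself.
  let T' := T.filter fun t => ∃ x ∈ D, cell x = t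
  have hT' : ∀ t : T', ∃ x ∈ D, cell x = t := fun t => (Finset.mem_filter.1 t.2).2
  choose rep hrepD hrep using hT'
  refine ⟨T'.attach.image rep, ?_, ?_, fun x hx => ?_⟩
  · intro y hy
    obtain ⟨t, -, rfl⟩ := Finset.mem_image.1 (Finset.mem_coe.1 hy)
    exact hrepD t
  · have h1 : (T'.attach.image rep).card ≤ T.card :=
      Finset.card_image_le.trans (by
        rw [Finset.card_attach]
        exact Finset.card_filter_le _ _)
    have h2 : (T.card : ℝ) ≤ (2 * (r / η) + 2) ^ m := by
      simp only [T, Fintype.card_piFinset_const, Int.card_Icc, Nat.cast_pow]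
      gcongr
      have hle : ⌊-(r / η)⌋ ≤ ⌊r / η⌋ := Int.floor_le_floor (by
        have : 0 ≤ r / η := by positivity
        linarith)
      have h3 : (((⌊r / η⌋ + 1 - ⌊-(r / η)⌋).toNat : ℤ) : ℝ) =
          ⌊r / η⌋ + 1 - ⌊-(r / η)⌋ := by
        rw [Int.toNat_of_nonneg (by omega)]
        push_cast
        ring
      rw [Int.cast_natCast] at h3
      rw [h3]
      linarith [Int.floor_le (r / η), Int.lt_floor_add_one (-(r / η))]
    calc ((T'.attach.image rep).card : ℝ) ≤ T.card := by exact_mod_cast h1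
      _ ≤ _ := h2
      _ ≤ ((2 * (r * (m + 1)) + 2) / δ) ^ m := by
        gcongr
        rw [hη, le_div_iff₀ hδ]
        have : r / (δ / (m + 1)) * δ = r * (m + 1) := by field_simp
        nlinarith
      _ = _ := by rw [div_pow, div_eq_mul_inv]
  · have ht : cell x ∈ T' := Finset.mem_filter.2 ⟨hcellT x hx, x, hx, rfl⟩
    exact ⟨rep ⟨cell x, ht⟩, Finset.mem_image_of_mem _ (Finset.mem_attach _ _),
      hcell _ _ (hrep ⟨cell x, ht⟩).symm⟩

/-- A `C¹` function on an open set is Lipschitz on its compact subsets. -/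
lemma ContDiffOn.exists_lipschitzOnWith_of_isCompact {E F : Type*} [NormedAddCommGroup E]
    [NormedSpace ℝ E] [NormedAddCommGroup F] [NormedSpace ℝ F] {f : E → F} {U K : Set E}
    (hf : ContDiffOn ℝ 1 f U) (hU : IsOpen U) (hK : IsCompact K) (hKU : K ⊆ U) :
    ∃ L, LipschitzOnWith L f K := by
  refine LocallyLipschitzOn.exists_lipschitzOnWith_of_compact hK fun x hx => ?_
  obtain ⟨L, t, ht, hL⟩ := (hf.contDiffAt (hU.mem_nhds (hKU hx))).exists_lipschitzOnWith
  exact ⟨L, t, mem_nhdsWithin_of_mem_nhds ht, hL⟩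

/-- Finitely many subpolynomial functions are Lipschitz on balls, with a constant that grows
polynomially in the radius. -/
lemma IsSubpolynomial.exists_abs_sub_le {p : ℕ} {d : Fin p → ℕ}
    {h : (i : Fin p) → EuclideanSpace ℝ (Fin (d i)) → ℝ} (hh : ∀ i, IsSubpolynomial (h i)) :
    ∃ (B : ℝ) (N : ℕ), 0 ≤ B ∧ ∀ i y z (R : ℝ), 1 ≤ R → ‖y‖ ≤ R → ‖z‖ ≤ R →
      |h i y - h i z| ≤ B * R ^ N * ‖y - z‖ := by
  choose hC1 C N hCN using hh
  refine ⟨(∑ i, |C i|) * 2 ^ (∑ i, N i), ∑ i, N i, by positivity,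
    fun i y z R hR hy hz => ?_⟩
  have hconv := convex_closedBall (0 : EuclideanSpace ℝ (Fin (d i))) R
  refine hconv.norm_image_sub_le_of_norm_fderiv_le (𝕜 := ℝ)
    (fun x _ => ((hC1 i).differentiable one_ne_zero) x) (fun x hx => ?_)
    (mem_closedBall_zero_iff.2 hz) (mem_closedBall_zero_iff.2 hy)
  have hx' : ‖x‖ ≤ R := mem_closedBall_zero_iff.1 hx
  have hCi : C i ≤ ∑ j, |C j| := (le_abs_self _).trans
    (Finset.single_le_sum (f := fun j => |C j|) (fun j _ => abs_nonneg _) (Finset.mem_univ i))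
  have hNi : N i ≤ ∑ j, N j :=
    Finset.single_le_sum (f := N) (fun j _ => Nat.zero_le _) (Finset.mem_univ i)
  calc _ ≤ C i * (1 + ‖x‖) ^ N i := (hCN i x).2
    _ ≤ (∑ j, |C j|) * (2 * R) ^ (∑ j, N j) := by
      refine mul_le_mul hCi ?_ (by positivity) (by positivity)
      calc (1 + ‖x‖) ^ N i ≤ (2 * R) ^ N i := by
            gcongr
            linarith
        _ ≤ _ := pow_le_pow_right₀ (by linarith) hNi
    _ = _ := by rw [mul_pow, mul_assoc]

/-- A quantity bounded by `a R^M τ + b R^{-k}`, for all `R ≥ 1` and every `k`, is `O(τ^α)` for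
every `α < 1`. -/
lemma exists_le_mul_rpow {f : ℝ → ℝ} (hf : ∀ τ, f τ ≤ 1) {a : ℝ} (ha : 0 ≤ a) (M : ℕ)
    (hk : ∀ k : ℕ, ∃ b : ℝ, 0 ≤ b ∧ ∀ τ : ℝ, 0 < τ → τ ≤ 1 → ∀ R : ℝ, 1 ≤ R →
      f τ ≤ a * R ^ M * τ + b * (R ^ k)⁻¹)
    {α : ℝ} (hα₀ : 0 ≤ α) (hα₁ : α < 1) :
    ∃ c : ℝ, 0 ≤ c ∧ ∀ τ : ℝ, 0 < τ → f τ ≤ c * τ ^ α := by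
  -- With `R = τ ^ (-η)` one has `R ^ M * τ ≤ τ ^ α` because `η * (M + 1) = 1 - α`, and `R ^ (-k) ≤
  -- τ ^ α` once `k ≥ α / η`.
  set η : ℝ := (1 - α) / (M + 1) with hη
  have hη0 : 0 < η := div_pos (by linarith) (by positivity)
  obtain ⟨b, hb, hbf⟩ := hk ⌈α / η⌉₊
  refine ⟨a + b + 1, by positivity, fun τ hτ => ?_⟩
  rcases le_or_gt τ 1 with hτ1 | hτ1
  · have hR : 1 ≤ τ ^ (-η) := Real.one_le_rpow_of_pos_of_le_one_of_nonpos hτ hτ1 (by linarith)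
    have h1 : (τ ^ (-η)) ^ M * τ ≤ τ ^ α := by
      rw [← Real.rpow_natCast, ← Real.rpow_mul hτ.le]
      nth_rewrite 2 [← Real.rpow_one τ]
      rw [← Real.rpow_add hτ]
      refine Real.rpow_le_rpow_of_exponent_ge hτ hτ1 ?_
      have h2 : η * (M + 1) = 1 - α := div_mul_cancel₀ _ (by positivity)
      nlinarith
    have h2 : ((τ ^ (-η)) ^ ⌈α / η⌉₊)⁻¹ ≤ τ ^ α := by
      rw [← Real.rpow_natCast, ← Real.rpow_mul hτ.le, ← Real.rpow_neg hτ.le]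
      refine Real.rpow_le_rpow_of_exponent_ge hτ hτ1 ?_
      have := (div_le_iff₀ hη0).1 (Nat.le_ceil (α / η))
      linarith
    have h3 : 0 ≤ τ ^ α := by positivity
    calc f τ ≤ a * (τ ^ (-η)) ^ M * τ + b * ((τ ^ (-η)) ^ ⌈α / η⌉₊)⁻¹ := hbf τ hτ hτ1 _ hR
      _ ≤ a * τ ^ α + b * τ ^ α := by
        rw [mul_assoc]
        gcongr
      _ ≤ _ := by linarith
  · have h3 : 1 ≤ τ ^ α := Real.one_le_rpow hτ1.le hα₀
    have : f τ ≤ 1 := hf τ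
    nlinarith

/-! ### The net argument for `ψ` -/

section

variable {Ω : Type*} [MeasurableSpace Ω] {P : Measure Ω} {m p : ℕ}
  {d : Fin p → ℕ} {g : (i : Fin p) → EuclideanSpace ℝ (Fin m) → Ω → EuclideanSpace ℝ (Fin (d i))}
  {U A D : Set (EuclideanSpace ℝ (Fin m))}

lemma IsSmoothCentredGaussianOn.integral_eq_zero (hg : IsSmoothCentredGaussianOn P g U) {x}
    (hx : x ∈ U) : ∫ ω, (fun i => g i x ω) ∂P = 0 := by
  funext i
  have h := (hg.gaussian.hasGaussianLaw_eval ⟨x, hx⟩).integrable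
  rw [eval_integral (fun i => h.eval i)]
  exact hg.centred i x hx

/-- Path by path, `C¹` regularity around the compact closure gives a random Lipschitz constant. This
provides the almost sure boundedness that Fernique's theorem upgrades to tails, both for `G` and for
its difference quotients. -/
lemma IsSmoothCentredGaussianOn.ae_lipschitzOnWith (hg : IsSmoothCentredGaussianOn P g U)
    (hU : IsOpen U) (hAb : Bornology.IsBounded A) (hAU : closure A ⊆ U) :
    ∀ᵐ ω ∂P, ∃ L, LipschitzOnWith L (fun x i => g i x ω) A := by
  filter_upwards [hg.smooth] with ω hω
  obtain ⟨L, hL⟩ := (contDiffOn_pi.2 hω).exists_lipschitzOnWith_of_isCompact hU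
    hAb.isCompact_closure hAU
  exact ⟨L, hL.mono subset_closure⟩

/-- The supremum of the field has polynomial tails of every order. -/
lemma IsSmoothCentredGaussianOn.exists_measureReal_norm_gt_le
    [IsProbabilityMeasure P] (hg : IsSmoothCentredGaussianOn P g U)
    (hU : IsOpen U) (hAb : Bornology.IsBounded A) (hAU : closure A ⊆ U) (hDA : D ⊆ A)
    (hD : D.Countable) (k : ℕ) : ∃ K : ℝ, 0 ≤ K ∧ ∀ R : ℝ, 0 < R →
      P.real {ω | ∃ x : D, R < ‖fun i => g i x ω‖} ≤ K * (R ^ k)⁻¹ := by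
  have hDU : ∀ x : D, (x : EuclideanSpace ℝ (Fin m)) ∈ U := fun x =>
    hAU (subset_closure (hDA x.2))
  have := hD.to_subtype
  refine IsGaussianProcess.exists_measureReal_exists_norm_gt_le
    (X := fun (x : D) ω i => g i x ω)
    (hg.gaussian.comp_right fun x : D => (⟨x, hDU x⟩ : U))
    (fun x => hg.integral_eq_zero (hDU x)) ?_ k
  filter_upwards [hg.ae_lipschitzOnWith hU hAb hAU] with ω ⟨L, hL⟩
  rcases D.eq_empty_or_nonempty with rfl | ⟨y, hy⟩
  · exact ⟨0, fun x => x.2.elim⟩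
  · obtain ⟨C, hC⟩ := Metric.isBounded_iff.1 hAb
    refine ⟨‖fun i => g i y ω‖ + L * C, fun x => ?_⟩
    have h1 := hL.dist_le_mul _ (hDA x.2) _ (hDA hy)
    have h2 := mul_le_mul_of_nonneg_left (hC (hDA x.2) (hDA hy)) L.coe_nonneg
    rw [dist_eq_norm] at h1
    have h3 := norm_le_norm_add_norm_sub' (fun i => g i x ω) (fun i => g i y ω)
    linarith

/-- The Lipschitz constant of the field has polynomial tails of every order. -/
lemma IsSmoothCentredGaussianOn.exists_measureReal_norm_sub_gt_le
    [IsProbabilityMeasure P] (hg : IsSmoothCentredGaussianOn P g U)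
    (hU : IsOpen U) (hAb : Bornology.IsBounded A) (hAU : closure A ⊆ U) (hDA : D ⊆ A)
    (hD : D.Countable) (k : ℕ) : ∃ K : ℝ, 0 ≤ K ∧ ∀ R : ℝ, 0 < R →
      P.real {ω | ∃ q : D × D, R < ‖‖(q.1 - q.2 : EuclideanSpace ℝ (Fin m))‖⁻¹ •
        ((fun i => g i q.1 ω) - fun i => g i q.2 ω)‖} ≤ K * (R ^ k)⁻¹ := by
  classical
  have hDU : ∀ x : D, (x : EuclideanSpace ℝ (Fin m)) ∈ U := fun x =>
    hAU (subset_closure (hDA x.2))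
  have := hD.to_subtype
  have hX := hg.gaussian.comp_right fun x : D => (⟨x, hDU x⟩ : U)
  refine IsGaussianProcess.exists_measureReal_exists_norm_gt_le
    (X := fun (q : D × D) ω => ‖(q.1 - q.2 : EuclideanSpace ℝ (Fin m))‖⁻¹ •
        ((fun i => g i q.1 ω) - fun i => g i q.2 ω)) ?_ (fun q => ?_) ?_ k
  · refine hX.of_isGaussianProcess fun q => ⟨{q.1, q.2},
      ‖(q.1 - q.2 : EuclideanSpace ℝ (Fin m))‖⁻¹ •
        (ContinuousLinearMap.proj ⟨q.1, by simp⟩ - ContinuousLinearMap.proj ⟨q.2, by simp⟩),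
      fun ω => ?_⟩
    rfl
  · have h1 := (hX.hasGaussianLaw_eval q.1).integrable
    have h2 := (hX.hasGaussianLaw_eval q.2).integrable
    rw [integral_smul]
    have := integral_sub h1 h2
    simp only [Function.comp_apply] at this
    rw [this, hg.integral_eq_zero (hDU q.1), hg.integral_eq_zero (hDU q.2), sub_zero, smul_zero]
  · filter_upwards [hg.ae_lipschitzOnWith hU hAb hAU] with ω ⟨L, hL⟩
    refine ⟨L, fun q => ?_⟩
    have h1 := hL.dist_le_mul _ (hDA q.1.2) _ (hDA q.2.2)
    rw [dist_eq_norm, dist_eq_norm] at h1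
    rw [norm_smul, norm_inv, norm_norm]
    rcases (norm_nonneg (q.1 - q.2 : EuclideanSpace ℝ (Fin m))).eq_or_lt with h0 | h0
    · rw [← h0]
      simp
    · rw [inv_mul_le_iff₀ h0]
      linarith

variable {h : (i : Fin p) → EuclideanSpace ℝ (Fin (d i)) → ℝ}

omit [MeasurableSpace Ω] in
lemma abs_compField_le (x : EuclideanSpace ℝ (Fin m)) (ω : Ω) (i : Fin p) :
    |h i (g i x ω)| ≤ ‖compField h g x ω‖ :=
  PiLp.norm_apply_le (compField h g x ω) i

/-- The first small ball estimate, for strict inequalities. -/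
theorem exists_measureReal_exists_norm_compField_lt_le [IsProbabilityMeasure P] (hp : m < p)
    (hAb : Bornology.IsBounded A) (hU : IsOpen U) (hAU : closure A ⊆ U)
    (hg : IsSmoothCentredGaussianOn P g U)
    (hG : ∃ C : ℝ≥0, ∀ x ∈ A,
      HasDensityBoundedOn (P.map (fun ω (i : Fin p) => g i x ω)) Set.univ C)
    {s : ℝ} (hs : 0 < s)
    (hcov : ∀ x ∈ A, ∀ v : (i : Fin p) → EuclideanSpace ℝ (Fin (d i)),
      ∫ ω, (∑ i, inner ℝ (v i) (g i x ω)) ^ 2 ∂P ≤ s ^ 2 * ∑ i, ‖v i‖ ^ 2)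
    (hh : ∀ i, IsSubpolynomial (h i))
    (hdens : ∀ i, ∃ ε : ℝ, 0 < ε ∧ ∃ C : ℝ≥0,
      HasDensityBoundedOn
        ((stdGaussian (EuclideanSpace ℝ (Fin (d i)))).map (fun y => h i (s • y)))
        (Set.Icc (-ε) ε) C)
    {α : ℝ} (hα₀ : 0 ≤ α) (hα₁ : α < 1) :
    ∃ c : ℝ, 0 ≤ c ∧ ∀ τ : ℝ, 0 < τ →
      P.real {ω | ∃ x ∈ A, ‖compField h g x ω‖ < τ} ≤ c * τ ^ α := by
  obtain ⟨C, hC⟩ := hG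
  have hhc : ∀ i, Continuous (h i) := fun i => (hh i).1.continuous
  obtain ⟨K, hK0, hK⟩ := exists_measureReal_forall_abs_le_le C hs h
    (fun i => (hhc i).measurable) hdens
  obtain ⟨B, N, hB0, hB⟩ := IsSubpolynomial.exists_abs_sub_le hh
  obtain ⟨KA, hKA0, hKA⟩ := exists_finset_net hAb
  obtain ⟨D, hDA, hD, hAD⟩ :=
    (TopologicalSpace.IsSeparable.of_separableSpace A).exists_countable_dense_subset
  refine exists_le_mul_rpow (a := KA * K * (1 + B) ^ p) (M := (N + 1) * p)
    (fun τ => measureReal_le_one) (by positivity) (fun k => ?_) hα₀ hα₁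
  obtain ⟨K₁, hK₁0, hK₁⟩ := hg.exists_measureReal_norm_gt_le hU hAb hAU hDA hD k
  obtain ⟨K₂, hK₂0, hK₂⟩ := hg.exists_measureReal_norm_sub_gt_le hU hAb hAU hDA hD k
  refine ⟨K₁ + K₂, by positivity, fun τ hτ hτ1 R hR => ?_⟩
  have hR0 : 0 < R := by linarith
  -- The net is taken inside the countable dense `D`, where the tail bounds are available.
  obtain ⟨F, hFD, hFcard, hF⟩ := hKA D hDA τ hτ hτ1
  set E₁ := {ω | ∃ x : D, R < ‖fun i => g i x ω‖}
  set E₂ := {ω | ∃ q : D × D, R < ‖‖(q.1 - q.2 : EuclideanSpace ℝ (Fin m))‖⁻¹ •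
        ((fun i => g i q.1 ω) - fun i => g i q.2 ω)‖}
  set θ : ℝ := (1 + B) * R ^ (N + 1) * τ with hθ
  have hθ0 : 0 ≤ θ := by positivity
  set E₃ := ⋃ y ∈ F, {ω | ∀ i, |h i (g i y ω)| ≤ θ}
  have hsub : {ω | ∃ x ∈ A, ‖compField h g x ω‖ < τ} ≤ᵐ[P] (E₁ ∪ E₂ ∪ E₃ : Set Ω) := by
    filter_upwards [hg.smooth] with ω hω hx
    obtain ⟨x, hxA, hx⟩ := hx
    by_cases h₁ : ω ∈ E₁
    · exact Or.inl (Or.inl h₁)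
    by_cases h₂ : ω ∈ E₂
    · exact Or.inl (Or.inr h₂)
    refine Or.inr ?_
    have h₁' : ∀ y ∈ D, ‖fun i => g i y ω‖ ≤ R := fun y hy => by
      by_contra hlt
      exact h₁ ⟨⟨y, hy⟩, not_le.1 hlt⟩
    have h₂' : ∀ y ∈ D, ∀ z ∈ D, ‖(fun i => g i y ω) - fun i => g i z ω‖ ≤ R * ‖y - z‖ :=
      fun y hy z hz => by
        by_contra hlt
        refine h₂ ⟨⟨⟨y, hy⟩, ⟨z, hz⟩⟩, ?_⟩
        have h0 : 0 < ‖y - z‖ := by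
          rw [norm_pos_iff, sub_ne_zero]
          rintro rfl
          simp at hlt
        rw [norm_smul, norm_inv, norm_norm, lt_inv_mul_iff₀ h0]
        linarith [not_le.1 hlt]
    have hcont : ContinuousOn (fun x => compField h g x ω) U := by
      refine (PiLp.continuous_toLp 2 _).comp_continuousOn (continuousOn_pi.2 fun i => ?_)
      exact (hhc i).comp_continuousOn (hω i).continuousOn
    have hxU : x ∈ U := hAU (subset_closure hxA)
    -- The strict inequality is an open condition, so `x` may be moved to a point of `D`.
    have hev := (hcont.continuousAt (hU.mem_nhds hxU)).norm.eventually (gt_mem_nhds hx)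
    obtain ⟨z, hzD, hz⟩ := ((mem_closure_iff_frequently.1 (hAD hxA)).and_eventually hev).exists
    obtain ⟨y, hyF, hzy⟩ := hF z hzD
    refine Set.mem_iUnion₂.2 ⟨y, hyF, fun i => ?_⟩
    have hyD : y ∈ D := hFD hyF
    have e1 := hB i (g i y ω) (g i z ω) R hR
      ((norm_le_pi_norm (fun i => g i y ω) i).trans (h₁' y hyD))
      ((norm_le_pi_norm (fun i => g i z ω) i).trans (h₁' z hzD))
    have e2 : ‖g i y ω - g i z ω‖ ≤ R * τ := by
      refine (norm_le_pi_norm ((fun i => g i y ω) - fun i => g i z ω) i).trans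
        ((h₂' y hyD z hzD).trans ?_)
      rw [norm_sub_rev]
      gcongr
    have e3 := (abs_compField_le (h := h) (g := g) z ω i).trans hz.le
    have e4 : |h i (g i y ω)| ≤ |h i (g i z ω)| + |h i (g i y ω) - h i (g i z ω)| := by
      have := abs_add_le (h i (g i z ω)) (h i (g i y ω) - h i (g i z ω))
      rwa [add_sub_cancel] at this
    have e5 : B * R ^ N * ‖g i y ω - g i z ω‖ ≤ B * R ^ N * (R * τ) := by gcongr
    have e6 : τ ≤ R ^ (N + 1) * τ := le_mul_of_one_le_left hτ.le (one_le_pow₀ hR)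
    have e7 : θ = R ^ (N + 1) * τ + B * R ^ N * (R * τ) := by
      rw [hθ]
      ring
    linarith
  have hE₃ : P.real E₃ ≤ KA * (τ ^ m)⁻¹ * (K * θ ^ p) := by
    refine (measureReal_biUnion_finset_le F _).trans ?_
    calc _ ≤ ∑ y ∈ F, K * θ ^ p := by
            refine Finset.sum_le_sum fun y hy => ?_
            have hyA : y ∈ A := hDA (hFD hy)
            have hyU : y ∈ U := hAU (subset_closure hyA)
            exact hK P (fun ω i => g i y ω) (hg.gaussian.hasGaussianLaw_eval ⟨y, hyU⟩)
              (fun i => hg.centred i y hyU) (hcov y hyA) (hC y hyA) θ hθ0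
      _ = F.card * (K * θ ^ p) := by simp
      _ ≤ _ := by gcongr
  have hθp : KA * (τ ^ m)⁻¹ * (K * θ ^ p) ≤
      KA * K * (1 + B) ^ p * R ^ ((N + 1) * p) * τ := by
    -- This is where `m < p` enters: at least one power of `τ` survives the union bound.
    have h1 : (τ ^ m)⁻¹ * τ ^ p ≤ τ := by
      rw [inv_mul_le_iff₀ (by positivity), ← pow_succ]
      exact pow_le_pow_of_le_one hτ.le hτ1 hp
    rw [hθ, mul_pow, mul_pow, ← pow_mul]
    calc _ = KA * K * (1 + B) ^ p * R ^ ((N + 1) * p) * ((τ ^ m)⁻¹ * τ ^ p) := by ring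
      _ ≤ _ := by gcongr
  have hle : P.real {ω | ∃ x ∈ A, ‖compField h g x ω‖ < τ} ≤ P.real (E₁ ∪ E₂ ∪ E₃) :=
    ENNReal.toReal_mono (measure_ne_top _ _) (measure_mono_ae hsub)
  have hu1 := measureReal_union_le (μ := P) (E₁ ∪ E₂) E₃
  have hu2 := measureReal_union_le (μ := P) E₁ E₂
  have h1 : P.real E₁ ≤ K₁ * (R ^ k)⁻¹ := hK₁ R hR0
  have h2 : P.real E₂ ≤ K₂ * (R ^ k)⁻¹ := hK₂ R hR0
  rw [add_mul K₁]
  linarith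

end

/-! ### Tails of the perturbing field `φ` -/

section

variable {Ω V ι : Type*} [MeasurableSpace Ω] {P : Measure Ω} [NormedAddCommGroup V]
  [MeasurableSpace V] [BorelSpace V] {X : ι → Ω → V}

/-- Markov's inequality for the supremum of a countable family. -/
lemma three_quarters_le_measure_forall_norm_le [IsProbabilityMeasure P] [Countable ι]
    (hX : ∀ i, AEMeasurable (X i) P) {a L : ℝ} (ha : 0 < a) (hL : 0 ≤ L) (haL : 4 * L ≤ a)
    (hint : ∫⁻ ω, ⨆ i, ‖X i ω‖ₑ ∂P ≤ ENNReal.ofReal L) :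
    3 / 4 ≤ P {ω | ∀ i, ‖X i ω‖ ≤ a} := by
  have hmark := mul_meas_ge_le_lintegral₀ (μ := P) (f := fun ω => ⨆ i, ‖X i ω‖ₑ)
    (AEMeasurable.iSup fun i => (hX i).enorm) (ENNReal.ofReal a)
  set bad := {ω | ENNReal.ofReal a ≤ ⨆ i, ‖X i ω‖ₑ}
  set good := {ω | ∀ i, ‖X i ω‖ ≤ a}
  have hcover : Set.univ ⊆ good ∪ bad := fun ω _ => by
    by_cases hω : ω ∈ good
    · exact Or.inl hω
    · obtain ⟨i, hi⟩ := not_forall.1 hω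
      refine Or.inr (le_trans ?_ (le_iSup (fun i => ‖X i ω‖ₑ) i))
      rw [← ofReal_norm]
      exact ENNReal.ofReal_le_ofReal (not_le.1 hi).le
  have h1 := ENNReal.toReal_mono ENNReal.ofReal_ne_top (hmark.trans hint)
  rw [ENNReal.toReal_mul, ENNReal.toReal_ofReal ha.le, ENNReal.toReal_ofReal hL] at h1
  -- From `a * P bad ≤ L ≤ a / 4`.
  have h2 : (P bad).toReal ≤ 1 / 4 := by
    by_contra hlt
    have := mul_lt_mul_of_pos_left (not_le.1 hlt) ha
    linarith
  have h3 : 1 ≤ P.real good + P.real bad := by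
    have := (measureReal_mono (μ := P) hcover).trans (measureReal_union_le good bad)
    simpa using this
  have h4 : (3 / 4 : ℝ) ≤ P.real good := by
    have : P.real bad = (P bad).toReal := rfl
    linarith
  rw [← ofReal_measureReal]
  refine le_trans (le_of_eq ?_) (ENNReal.ofReal_le_ofReal h4)
  rw [ENNReal.ofReal_div_of_pos (by norm_num)]
  norm_num

end

section

variable {Ω : Type*} [MeasurableSpace Ω] {P : Measure Ω} {m p : ℕ}
  {φ : EuclideanSpace ℝ (Fin m) → Ω → EuclideanSpace ℝ (Fin p)}
  {A D : Set (EuclideanSpace ℝ (Fin m))}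

/-- By continuity, exceedances over `A` already occur on a dense subset. -/
lemma IsContinuousCentredGaussianOn.measure_exists_lt_le
    (hφ : IsContinuousCentredGaussianOn P φ A) (hDA : D ⊆ A) (hAD : A ⊆ closure D) (t : ℝ) :
    P {ω | ∃ x ∈ A, t < ‖φ x ω‖} ≤ P {ω | ∃ x : D, t < ‖φ x ω‖} := by
  refine measure_mono_ae ?_
  filter_upwards [hφ.continuous] with ω hω hx
  obtain ⟨x, hxA, hx⟩ := hx
  have hev := ((hω x hxA).mono hDA).norm.eventually (lt_mem_nhds hx)
  have : (nhdsWithin x D).NeBot := mem_closure_iff_nhdsWithin_neBot.1 (hAD hxA)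
  obtain ⟨z, hz, hzD⟩ := (hev.and self_mem_nhdsWithin).exists
  exact ⟨⟨z, hzD⟩, hz⟩

lemma lintegral_iSup_le_meanSupNorm (hDA : D ⊆ A) :
    ∫⁻ ω, ⨆ x : D, ‖φ x ω‖ₑ ∂P ≤ meanSupNorm P φ A :=
  lintegral_mono fun ω => iSup_le fun x =>
    le_iSup₂ (f := fun x (_ : x ∈ A) => ‖φ x ω‖ₑ) (x : EuclideanSpace ℝ (Fin m)) (hDA x.2)

/-- A field with vanishing mean supremum vanishes almost surely. -/
lemma IsContinuousCentredGaussianOn.measure_exists_pos_eq_zero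
    (hφ : IsContinuousCentredGaussianOn P φ A) (h0 : meanSupNorm P φ A = 0) :
    P {ω | ∃ x ∈ A, 0 < ‖φ x ω‖} = 0 := by
  obtain ⟨D, hDA, hD, hAD⟩ :=
    (TopologicalSpace.IsSeparable.of_separableSpace A).exists_countable_dense_subset
  have := hD.to_subtype
  refine le_antisymm ((hφ.measure_exists_lt_le hDA hAD 0).trans (le_of_eq ?_)) zero_le
  have h1 : ∫⁻ ω, ⨆ x : D, ‖φ x ω‖ₑ ∂P = 0 :=
    le_antisymm ((lintegral_iSup_le_meanSupNorm hDA).trans h0.le) zero_le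
  rw [lintegral_eq_zero_iff' (AEMeasurable.iSup fun x : D =>
    (hφ.gaussian.aemeasurable ⟨x, hDA x.2⟩).enorm)] at h1
  rw [← compl_compl {ω | ∃ x : D, 0 < ‖φ x ω‖}, ← mem_ae_iff]
  filter_upwards [h1] with ω hω hex
  obtain ⟨x, hx⟩ := hex
  have h2 : ‖φ x ω‖ₑ = 0 := by
    have := (iSup_eq_bot.1 hω) x
    exact this
  rw [enorm_eq_zero] at h2
  simp [h2] at hx

/-- The supremum of the field exceeds multiples of its mean with polynomially small
probability. -/
lemma IsContinuousCentredGaussianOn.measureReal_exists_gt_le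
    [IsProbabilityMeasure P] (hφ : IsContinuousCentredGaussianOn P φ A) {L r : ℝ} (hL : 0 < L) (hr : 0 < r)
    (hsup : meanSupNorm P φ A ≤ ENNReal.ofReal L) (k : ℕ) :
    P.real {ω | ∃ x ∈ A, 4 * L * r < ‖φ x ω‖} ≤ gaussianTailPowConst k * (r ^ k)⁻¹ := by
  obtain ⟨D, hDA, hD, hAD⟩ :=
    (TopologicalSpace.IsSeparable.of_separableSpace A).exists_countable_dense_subset
  have := hD.to_subtype
  refine (ENNReal.toReal_mono (measure_ne_top _ _)
    (hφ.measure_exists_lt_le hDA hAD _)).trans ?_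
  refine IsGaussianProcess.measureReal_exists_norm_gt_le (ι := D) (X := fun x ω => φ x ω)
    (hφ.gaussian.comp_right fun x : D => (⟨x, hDA x.2⟩ : A))
    (fun x => hφ.centred x (hDA x.2)) (by positivity) hr ?_ k
  exact three_quarters_le_measure_forall_norm_le (ι := D) (X := fun x ω => φ x ω)
    (fun x => hφ.gaussian.aemeasurable ⟨x, hDA x.2⟩) (by positivity) hL.le le_rfl
    ((lintegral_iSup_le_meanSupNorm hDA).trans hsup)

end

/-! ### Conclusion -/

/-- The factor `max v 1` is used only through being at least `1`; the size of `A` already sits in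
the constant via the net. -/
lemma ENNReal.le_coe_mul_max_mul_rpow {x v : ℝ≥0∞} {c : ℝ≥0} {b τ α : ℝ} (hτ : 0 < τ)
    (hx : x ≤ ENNReal.ofReal (b * τ ^ α)) (hb : b ≤ c) :
    x ≤ c * max v 1 * ENNReal.ofReal τ ^ α := by
  calc x ≤ ENNReal.ofReal (c * τ ^ α) := hx.trans (ENNReal.ofReal_le_ofReal
        (mul_le_mul_of_nonneg_right hb (by positivity)))
    _ = c * 1 * ENNReal.ofReal τ ^ α := by
        rw [ENNReal.ofReal_mul c.coe_nonneg, ENNReal.ofReal_coe_nnreal, mul_one,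
          ENNReal.ofReal_rpow_of_pos hτ]
    _ ≤ _ := by
        gcongr
        exact le_max_right _ _

theorem mainTheorem4 {Ω : Type*} [MeasurableSpace Ω] (P : Measure Ω) [IsProbabilityMeasure P]
    (p' p : ℕ) (hp : p' < p) (d : Fin p → ℕ)
    (A U : Set (EuclideanSpace ℝ (Fin p')))
    (hA : MeasurableSet A) (hAb : Bornology.IsBounded A)
    (hU : IsOpen U) (hAU : closure A ⊆ U)
    (g : (i : Fin p) → EuclideanSpace ℝ (Fin p') → Ω → EuclideanSpace ℝ (Fin (d i)))
    (hg : IsSmoothCentredGaussianOn P g U)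
    -- the vectors `G(x) = (g 1 x, …, g p x)`, `x ∈ A`, have a uniformly bounded density
    (hG : ∃ C : ℝ≥0, ∀ x ∈ A,
      HasDensityBoundedOn (P.map (fun ω (i : Fin p) => g i x ω)) Set.univ C)
    -- `s ^ 2` bounds the eigenvalues of the covariance matrices of `G(x)`, `x ∈ A`
    (s : ℝ) (hs : 0 < s)
    (hcov : ∀ x ∈ A, ∀ v : (i : Fin p) → EuclideanSpace ℝ (Fin (d i)),
      ∫ ω, (∑ i, inner ℝ (v i) (g i x ω)) ^ 2 ∂P ≤ s ^ 2 * ∑ i, ‖v i‖ ^ 2)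
    (h : (i : Fin p) → EuclideanSpace ℝ (Fin (d i)) → ℝ)
    (hh : ∀ i, IsSubpolynomial (h i))
    -- `h i (s X)`, with `X` standard Gaussian, has a density that is bounded near `0`
    (hdens : ∀ i, ∃ ε : ℝ, 0 < ε ∧ ∃ C : ℝ≥0,
      HasDensityBoundedOn
        ((stdGaussian (EuclideanSpace ℝ (Fin (d i)))).map (fun y => h i (s • y)))
        (Set.Icc (-ε) ε) C)
    (α : ℝ) (hα₀ : 0 ≤ α) (hα₁ : α < 1) :
    (∃ c : ℝ≥0, ∀ τ : ℝ, 0 < τ →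
      P {ω | (⨅ x ∈ A, ‖compField h g x ω‖ₑ) ≤ ENNReal.ofReal τ} ≤
        c * max (volume A) 1 * ENNReal.ofReal τ ^ α) ∧
    (∀ K : ℝ≥0, ∃ c' : ℝ≥0,
      ∀ φ : EuclideanSpace ℝ (Fin p') → Ω → EuclideanSpace ℝ (Fin p),
        IsContinuousCentredGaussianOn P φ A →
        meanSupNorm P φ A ≤ K * maxStdDev P φ A →
        P {ω | ∃ x ∈ A, ‖compField h g x ω‖ < ‖φ x ω‖} ≤
          c' * max (volume A) 1 * maxStdDev P φ A ^ α) := by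
  have main : ∀ β : ℝ, 0 ≤ β → β < 1 → ∃ c : ℝ, 0 ≤ c ∧ ∀ τ : ℝ, 0 < τ →
      P.real {ω | ∃ x ∈ A, ‖compField h g x ω‖ < τ} ≤ c * τ ^ β := fun β hβ₀ hβ₁ =>
    exists_measureReal_exists_norm_compField_lt_le hp hAb hU hAU hg hG hs hcov hh hdens hβ₀ hβ₁
  refine ⟨?_, fun K => ?_⟩
  · obtain ⟨c, hc0, hc⟩ := main α hα₀ hα₁
    refine ⟨(c * 2 ^ α).toNNReal, fun τ hτ => ?_⟩
    refine ENNReal.le_coe_mul_max_mul_rpow (b := c * 2 ^ α) hτ ?_ (Real.le_coe_toNNReal _)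
    -- The infimum need not be attained on `A`; doubling `τ` yields a point with a strict
    -- inequality.
    have hsub : {ω | (⨅ x ∈ A, ‖compField h g x ω‖ₑ) ≤ ENNReal.ofReal τ} ⊆
        {ω | ∃ x ∈ A, ‖compField h g x ω‖ < 2 * τ} := fun ω hω => by
      have hlt : (⨅ x ∈ A, ‖compField h g x ω‖ₑ) < ENNReal.ofReal (2 * τ) :=
        lt_of_le_of_lt hω ((ENNReal.ofReal_lt_ofReal_iff (by positivity)).2 (by linarith))
      simp only [iInf_lt_iff] at hlt
      obtain ⟨x, hxA, hx⟩ := hlt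
      rw [← ofReal_norm, ENNReal.ofReal_lt_ofReal_iff (by positivity)] at hx
      exact ⟨x, hxA, hx⟩
    refine (measure_mono hsub).trans ?_
    rw [← ofReal_measureReal]
    refine ENNReal.ofReal_le_ofReal ((hc (2 * τ) (by positivity)).trans (le_of_eq ?_))
    rw [Real.mul_rpow (by norm_num) hτ.le, mul_assoc]
  -- Any `β` with `α < β < 1` would do. Then `γ = α / β < 1`, the small ball bound at level `τ ^ γ`
  -- is `τ ^ α`, and `k` is large enough that the tail of `φ` at that level is `O(τ ^ α)` too.
  · set β : ℝ := (1 + α) / 2 with hβ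
    obtain ⟨c, hc0, hc⟩ := main β (by linarith) (by linarith)
    have hβ0 : 0 < β := by linarith
    set γ : ℝ := α / β with hγ
    have hγβ : γ * β = α := div_mul_cancel₀ _ hβ0.ne'
    have hγ1 : γ < 1 := by
      rw [hγ, div_lt_one hβ0]
      linarith
    set k : ℕ := ⌈α / (1 - γ)⌉₊ with hk
    have hkα : α ≤ k * (1 - γ) := (div_le_iff₀ (by linarith)).1 (Nat.le_ceil _)
    set M : ℝ := gaussianTailPowConst k * (4 * (K + 1)) ^ k with hM
    have hM0 : 0 ≤ M := mul_nonneg (gaussianTailPowConst_nonneg k) (by positivity)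
    refine ⟨(M + c + 1).toNNReal, fun φ hφ hmean => ?_⟩
    have hcoe : ((M + c + 1).toNNReal : ℝ) = M + c + 1 := Real.coe_toNNReal _ (by positivity)
    set σ := maxStdDev P φ A with hσ
    rcases le_or_gt 1 σ with hσ1 | hσ1
    · refine prob_le_one.trans ?_
      have h1 : (1 : ℝ≥0∞) ≤ (M + c + 1).toNNReal := by
        rw [← ENNReal.coe_one, ENNReal.coe_le_coe, ← NNReal.coe_le_coe, hcoe]
        simp only [NNReal.coe_one]
        linarith
      refine one_le_mul (one_le_mul h1 (le_max_right _ _)) ?_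
      rcases hα₀.eq_or_lt with h0 | h0
      · simp [← h0]
      · exact ENNReal.one_le_rpow hσ1 h0
    -- Here `φ` vanishes almost surely, and the event forces `‖φ x ω‖ > 0`.
    rcases eq_or_ne σ 0 with hσ0 | hσ0
    · rw [hσ0, mul_zero] at hmean
      have := hφ.measure_exists_pos_eq_zero (le_antisymm hmean zero_le)
      refine (measure_mono ?_).trans (this.le.trans zero_le)
      rintro ω ⟨x, hxA, hx⟩
      exact ⟨x, hxA, (norm_nonneg _).trans_lt hx⟩
    have hσtop : σ ≠ ∞ := (hσ1.trans ENNReal.one_lt_top).ne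
    set τ : ℝ := σ.toReal with hτ
    have hτ0 : 0 < τ := ENNReal.toReal_pos hσ0 hσtop
    have hτ1 : τ ≤ 1 := by
      have := ENNReal.toReal_mono ENNReal.one_ne_top hσ1.le
      simpa using this
    have hστ : σ = ENNReal.ofReal τ := (ENNReal.ofReal_toReal hσtop).symm
    rw [hστ]
    refine ENNReal.le_coe_mul_max_mul_rpow (b := M + c) hτ0 ?_ (by linarith)
    -- `K + 1` instead of `K` keeps the scale positive when `K = 0`.
    have hmean' : meanSupNorm P φ A ≤ ENNReal.ofReal ((K + 1) * τ) := by
      refine hmean.trans ?_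
      rw [hστ, ← ENNReal.ofReal_coe_nnreal, ← ENNReal.ofReal_mul K.coe_nonneg]
      refine ENNReal.ofReal_le_ofReal ?_
      nlinarith
    set r : ℝ := τ ^ γ / (4 * ((K + 1) * τ)) with hr
    have hr0 : 0 < r := by positivity
    have hLr : 4 * ((K + 1) * τ) * r = τ ^ γ := mul_div_cancel₀ _ (by positivity)
    have htail := hφ.measureReal_exists_gt_le (L := (K + 1) * τ) (by positivity) hr0 hmean' k
    rw [hLr] at htail
    have hpow : (r ^ k)⁻¹ ≤ (4 * (K + 1)) ^ k * τ ^ α := by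
      have hrinv : r⁻¹ = 4 * (K + 1) * τ ^ (1 - γ) := by
        rw [hr, inv_div, Real.rpow_sub hτ0, Real.rpow_one]
        ring
      rw [← inv_pow, hrinv, mul_pow]
      gcongr
      rw [← Real.rpow_natCast, ← Real.rpow_mul hτ0.le]
      refine Real.rpow_le_rpow_of_exponent_ge hτ0 hτ1 ?_
      linarith
    have hsmall := hc (τ ^ γ) (by positivity)
    rw [← Real.rpow_mul hτ0.le, hγβ] at hsmall
    have hsub : {ω | ∃ x ∈ A, ‖compField h g x ω‖ < ‖φ x ω‖} ⊆
        {ω | ∃ x ∈ A, τ ^ γ < ‖φ x ω‖} ∪ {ω | ∃ x ∈ A, ‖compField h g x ω‖ < τ ^ γ} := by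
      rintro ω ⟨x, hxA, hx⟩
      rcases lt_or_ge (τ ^ γ) ‖φ x ω‖ with hlt | hle
      · exact Or.inl ⟨x, hxA, hlt⟩
      · exact Or.inr ⟨x, hxA, hx.trans_le hle⟩
    rw [← ofReal_measureReal]
    refine ENNReal.ofReal_le_ofReal ?_
    have h1 := (measureReal_mono (μ := P) hsub).trans (measureReal_union_le _ _)
    have h2 := mul_le_mul_of_nonneg_left hpow (gaussianTailPowConst_nonneg k)
    rw [← mul_assoc, ← hM] at h2
    rw [add_mul]
    linarith
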